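/- Let $p>5$ be a prime. For $x\in\mathbb{Q}\cap\mathbb{Z}_p$ let $[x]_0\in\{0,1,\dots,p-1\}$ be the first $p$-adic digit of $x$ (so $x\equiv[x]_0 \bmod p$), and let $r\mapsto r'=(r+[-r]_0)/p$ be Dwork's dash operation. Let $r_1,r_2\in\mathbb{Q}\cap\mathbb{Z}_p^\times$ be such that the multi-set $\alpha=\{r_1,1-r_1,r_2,1-r_2\}$ is closed under the dash operation, in the sense that $r\mapsto r'$ permutes the multi-set $\alpha$, i.e. $\{r_1',(1-r_1)',r_2',(1-r_2)'\}=\{r_1,1-r_1,r_2,1-r_2\}$ with multiplicities. For $s\ge1$ put $$F_s=F_s(\alpha)=\sum_{k=0}^{p^s-1}\frac{(r_1)_k(1-r_1)_k(r_2)_k(1-r_2)_k}{k!^4},\qquad (a)_k=a(a+1)\cdots(a+k-1).$$ Then all $F_s$, $s\ge1$, lie in $\mathbb{Z}_p$, and for every integer $s\ge1$ $$F_{s+1}(\alpha)\equiv F_s(\alpha)\,F_1(\alpha)\pmod{p^3}.$$ -/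

import Mathlib

/-- `[x]₀`: the first `p`-adic digit, in `{0, …, p - 1}`, of a rational number `x` that is a
`p`-adic integer (and `0`, by convention, if `x` is not a `p`-adic integer). -/
noncomputable def firstDigit (p : ℕ) [Fact p.Prime] (x : ℚ) : ℕ :=
  open Classical in
  if h : ‖(x : ℚ_[p])‖ ≤ 1 then PadicInt.zmodRepr (⟨(x : ℚ_[p]), h⟩ : ℤ_[p]) else 0

/-- Dwork's dash operation `r ↦ r' = (r + [-r]₀) / p`. -/
noncomputable def dworkDash (p : ℕ) [Fact p.Prime] (r : ℚ) : ℚ :=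
  (r + (firstDigit p (-r) : ℚ)) / (p : ℚ)

/-- A multi-set `α` of rational numbers is closed under Dwork's dash operation: the operation
permutes `α` (with multiplicities). -/
def IsDashClosed (p : ℕ) [Fact p.Prime] (α : Multiset ℚ) : Prop :=
  α.map (dworkDash p) = α

/-- The Pochhammer symbol (rising factorial) `(a)_k = a (a + 1) ⋯ (a + k - 1)`. -/
def risingFactorial (a : ℚ) (k : ℕ) : ℚ :=
  ∏ i ∈ Finset.range k, (a + (i : ℚ))

/-- The hypergeometric series with multi-set of upper parameters `α` and lower parameters `β`
at `x`, truncated after the term with index `n`: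
`∑_{k=0}^{n} (∏_{a ∈ α} (a)_k) / ((∏_{b ∈ β} (b)_k) k!) x ^ k`. -/
noncomputable def truncHyp (α β : Multiset ℚ) (x : ℚ) (n : ℕ) : ℚ :=
  ∑ k ∈ Finset.range (n + 1),
    (α.map fun a => risingFactorial a k).prod /
      ((β.map fun b => risingFactorial b k).prod * (k.factorial : ℚ)) * x ^ k

/-- `F_s(α)`: the series `₄F₃(α; 1, 1, 1; 1)` truncated at `k = p ^ s - 1`. -/
noncomputable def dworkTrunc (p : ℕ) (α : Multiset ℚ) (s : ℕ) : ℚ :=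
  truncHyp α {1, 1, 1} 1 (p ^ s - 1)

/-! Put c_r(k) = (r)_k (1-r)_k / k!². For k = pb + a with 0 ≤ a < p, pulling one multiple of p out
of each complete block of p factors gives c_r(pb+a) = c_{r'}(b) w_r(a,b), where w is `dworkRatio`.
Closedness under the dash makes c_{r₁'}(b) c_{r₂'}(b) the b-th term of the series, so it suffices
that the block sum ∑_a w_{r₁}(a,b) w_{r₂}(a,b) is independent of b modulo p³
(`pow_three_dvd_sum_dworkRatio_sub`).

Write r₁ = pρ - m, r₂ = pσ - n and let ρ, σ vary freely in ℤ_p. As polynomials in Y = pρ, the ratios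
for b and for 0 differ modulo p by a multiple of Y^(p-1). Hence the change of the block sum is,
modulo p³, an affine function of (ρ, σ) (`exists_affine_sum_dworkRatio_sub`), and three points
decide it: (0,0), (1,0), (0,1). The symmetry r ↦ 1 - r turns ρ = 1 into ρ = 0, so only the
parameters -m, -n remain.

There, with x = pb > 0 and e_k the coefficients of ₂F₁(-m, m+1; 1; ·), partial fractions give w =
e_a + x ∑_{k≠a} e_k/(x+a-k) (`dworkRatio_neg_eq`). In the sum of products the terms linear in x
cancel to order x² by antisymmetry in a and k, and the total coefficient of x² vanishes modulo p
because ∑_a 1/((a-k)(a-l)) ≡ 2/(k-l)² (`pow_three_dvd_sum_mul_sub`). -/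

/-! ### Block decomposition of rising factorials -/

open Finset in
/-- The product of the `y + i`, `i < p * b + a`, over the indices `i` such that `i < p * b` is not
congruent to `m` modulo `p`, or `p * b ≤ i`. -/
def unitRising {R : Type*} [CommRing R] (p m a b : ℕ) (y : R) : R :=
  (∏ j ∈ range b, ∏ l ∈ (range p).erase m, (y + ((p * j + l : ℕ) : R))) *
    ∏ l ∈ range a, (y + ((p * b + l : ℕ) : R))

theorem map_unitRising {R S : Type*} [CommRing R] [CommRing S] (f : R →+* S) (p m a b : ℕ) (y : R) :
    f (unitRising p m a b y) = unitRising p m a b (f y) := by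
  simp [unitRising, map_prod]

theorem Finset.prod_range_mul_block {M : Type*} [CommMonoid M] (f : ℕ → M) (p b : ℕ) :
    ∏ i ∈ range (p * b), f i = ∏ j ∈ range b, ∏ l ∈ range p, f (p * j + l) := by
  induction b with
  | zero => simp
  | succ b ih => rw [Nat.mul_succ, prod_range_add, ih, prod_range_succ]

theorem Finset.sum_range_mul_block {M : Type*} [AddCommMonoid M] (f : ℕ → M) (p b : ℕ) :
    ∑ i ∈ range (p * b), f i = ∑ j ∈ range b, ∑ l ∈ range p, f (p * j + l) := by
  induction b with
  | zero => simp
  | succ b ih => rw [Nat.mul_succ, sum_range_add, ih, sum_range_succ]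

-- In block j the factor of index l = m is p(ρ + j). The incomplete last block is kept whole, even
-- if a > m, so exactly p^b and (ρ)_b come out.
open Finset in
theorem prod_range_add_eq_unitRising {R : Type*} [CommRing R] {p m : ℕ} (hm : m < p) (a b : ℕ)
    {y ρ : R} (h : y + m = p * ρ) :
    ∏ i ∈ range (p * b + a), (y + (i : R)) =
      (p : R) ^ b * (∏ i ∈ range b, (ρ + (i : R))) * unitRising p m a b y := by
  rw [prod_range_add, prod_range_mul_block, unitRising, ← mul_assoc]
  congr 1
  have : ∀ j, ∏ l ∈ range p, (y + ((p * j + l : ℕ) : R)) =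
      (p * (ρ + j)) * ∏ l ∈ (range p).erase m, (y + ((p * j + l : ℕ) : R)) := by
    intro j
    rw [← mul_prod_erase _ _ (mem_range.mpr hm)]
    congr 1
    push_cast
    linear_combination h
  simp_rw [this, prod_mul_distrib]
  simp

/-- The case y = ρ = 1, m = p - 1; the power p^b later cancels against the numerators. -/
theorem factorial_eq_unitRising (R : Type*) [CommRing R] {p : ℕ} (hp : 0 < p) (a b : ℕ) :
    ((p * b + a).factorial : R) =
      (p : R) ^ b * (b.factorial : R) * unitRising p (p - 1) a b (1 : R) := by
  have h : (1 : R) + ((p - 1 : ℕ) : R) = p * 1 := by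
    rw [Nat.cast_sub hp]; simp
  have fac : ∀ n : ℕ, (n.factorial : R) = ∏ i ∈ Finset.range n, (1 + (i : R)) := by
    intro n
    rw [← Finset.prod_range_add_one_eq_factorial]
    push_cast
    exact Finset.prod_congr rfl fun _ _ => add_comm _ _
  rw [fac, fac, prod_range_add_eq_unitRising (Nat.sub_lt hp one_pos) a b h]

/-! ### Reduction modulo p -/

section PadicUnits

variable {p : ℕ} [Fact p.Prime]

theorem PadicInt.toZMod_eq_zero_iff_dvd (x : ℤ_[p]) : PadicInt.toZMod x = 0 ↔ (p : ℤ_[p]) ∣ x := by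
  rw [← RingHom.mem_ker, PadicInt.ker_toZMod, PadicInt.maximalIdeal_eq_span_p,
    Ideal.mem_span_singleton]

theorem PadicInt.isUnit_iff_toZMod_ne_zero (x : ℤ_[p]) : IsUnit x ↔ PadicInt.toZMod x ≠ 0 := by
  rw [← not_iff_not, not_not, ← RingHom.mem_ker, PadicInt.ker_toZMod, IsLocalRing.mem_maximalIdeal]
  rfl

theorem PadicInt.toZMod_ringInverse (x : ℤ_[p]) :
    PadicInt.toZMod (Ring.inverse x) = (PadicInt.toZMod x)⁻¹ := by
  by_cases h : IsUnit x
  · refine eq_inv_of_mul_eq_one_left ?_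
    rw [← map_mul, Ring.inverse_mul_cancel _ h, map_one]
  · rw [Ring.inverse_non_unit _ h, map_zero]
    rw [PadicInt.isUnit_iff_toZMod_ne_zero, not_not] at h
    rw [h, inv_zero]

open Polynomial in
theorem ZMod.prod_X_sub_C_erase_zero :
    ∏ c ∈ (Finset.univ : Finset (ZMod p)).erase 0, (X - C c) = X ^ (p - 1) - 1 := by
  have hp := (Fact.out : p.Prime)
  have hroots : (X ^ p - X : (ZMod p)[X]).roots = Finset.univ.val := by
    simpa [ZMod.card] using FiniteField.roots_X_pow_card_sub_X (ZMod p)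
  have hdeg := FiniteField.X_pow_card_sub_X_natDegree_eq (ZMod p) hp.one_lt
  have hmonic : (X ^ p - X : (ZMod p)[X]).Monic :=
    monic_X_pow_sub (by rw [degree_X]; exact_mod_cast hp.one_lt)
  have h := prod_multiset_X_sub_C_of_monic_of_roots_card_eq hmonic
    (by rw [hroots, hdeg]; simp [ZMod.card])
  rw [hroots] at h
  change ∏ c : ZMod p, (X - C c) = _ at h
  rw [← Finset.mul_prod_erase _ _ (Finset.mem_univ (0 : ZMod p)), map_zero, sub_zero] at h
  refine mul_left_cancel₀ (X_ne_zero (R := ZMod p)) ?_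
  rw [h, mul_sub, mul_one, ← pow_succ', Nat.sub_add_cancel hp.one_le]

/-- `∏ (Y - m + l)` over the residues `l ≠ m` modulo `p`. -/
theorem prod_erase_sub_add {A : Type*} [CommRing A] [Algebra (ZMod p) A] {m : ℕ} (hm : m < p)
    (Y : A) : ∏ l ∈ (Finset.range p).erase m, (Y - (m : A) + (l : A)) = Y ^ (p - 1) - 1 := by
  have h := congrArg (Polynomial.aeval Y) (ZMod.prod_X_sub_C_erase_zero (p := p))
  simp only [map_prod, map_sub, Polynomial.aeval_X, Polynomial.aeval_C, map_pow, map_one] at h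
  rw [← h]
  refine Finset.prod_bij' (fun l _ => (m : ZMod p) - (l : ZMod p))
    (fun c _ => ((m : ZMod p) - c).val) ?_ ?_ ?_ ?_ ?_
  · intro l hl
    simp only [Finset.mem_erase, Finset.mem_range] at hl
    simp only [Finset.mem_erase, Finset.mem_univ, and_true, ne_eq, sub_eq_zero]
    intro h
    rw [ZMod.natCast_eq_natCast_iff', Nat.mod_eq_of_lt hm, Nat.mod_eq_of_lt hl.2] at h
    exact hl.1 h.symm
  · intro c hc
    simp only [Finset.mem_erase, Finset.mem_univ, and_true] at hc
    simp only [Finset.mem_erase, Finset.mem_range, ZMod.val_lt, and_true]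
    intro h
    have := congrArg (Nat.cast (R := ZMod p)) h
    rw [ZMod.natCast_zmod_val] at this
    exact hc (by linear_combination -this)
  · intro l hl
    simp only [Finset.mem_erase, Finset.mem_range] at hl
    simp [ZMod.val_cast_of_lt hl.2]
  · intro c _
    simp
  · intro l _
    simp
    ring

/-- In characteristic p all complete blocks are equal. The algebra A is `ZMod p` for the
denominators (with Y = 0) and `(ZMod p)[X]` for the numerators. -/
theorem unitRising_algebra_zmod {A : Type*} [CommRing A] [Algebra (ZMod p) A] {m : ℕ} (hm : m < p)
    (a b : ℕ) (Y : A) : unitRising p m a b (Y - (m : A)) =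
      (Y ^ (p - 1) - 1) ^ b * ∏ l ∈ Finset.range a, (Y - (m : A) + (l : A)) := by
  have hp0 : (p : A) = 0 := by
    rw [← map_natCast (algebraMap (ZMod p) A), CharP.cast_eq_zero, map_zero]
  simp [unitRising, hp0, prod_erase_sub_add hm]

theorem isUnit_unitRising_one {a : ℕ} (ha : a < p) (b : ℕ) :
    IsUnit (unitRising p (p - 1) a b (1 : ℤ_[p])) := by
  have hp := (Fact.out : p.Prime)
  rw [PadicInt.isUnit_iff_toZMod_ne_zero, map_unitRising]
  have h1 : PadicInt.toZMod (1 : ℤ_[p]) = (0 : ZMod p) - ((p - 1 : ℕ) : ZMod p) := by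
    rw [map_one, Nat.cast_sub hp.pos]; simp
  rw [h1, unitRising_algebra_zmod (Nat.sub_lt hp.pos one_pos), ← h1,
    zero_pow (Nat.sub_pos_of_lt hp.one_lt).ne']
  refine mul_ne_zero (pow_ne_zero _ (by simp)) (Finset.prod_ne_zero_iff.mpr fun l hl => ?_)
  have : ((l + 1 : ℕ) : ZMod p) ≠ 0 := by
    rw [Ne, ZMod.natCast_eq_zero_iff]
    exact Nat.not_dvd_of_pos_of_lt l.succ_pos (by have := Finset.mem_range.mp hl; omega)
  simpa [add_comm] using this

end PadicUnits

/-! ### The block sum as an affine function of the dashed parameters -/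

section Interpolation

variable {p : ℕ} [Fact p.Prime]

open Polynomial

theorem Polynomial.eval_eq_coeff_add_divX {R : Type*} [CommRing R] (f : R[X]) (y : R) :
    f.eval y = f.coeff 0 + y * f.divX.eval y := by
  conv_lhs => rw [← divX_mul_X_add f]
  simp
  ring

/-- The ratio of the `(p * b + a)`-th coefficient for the parameters `y`, `1 - y` to the `b`-th one
for their images under Dwork's operation, if `y ≡ -m` modulo `p`. -/
noncomputable def dworkRatio (p : ℕ) [Fact p.Prime] (m a b : ℕ) (y : ℤ_[p]) : ℤ_[p] :=
  Ring.inverse (unitRising p (p - 1) a b 1) ^ 2 * unitRising p m a b y *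
    unitRising p (p - 1 - m) a b (1 - y)

/-- `dworkRatio p m a b (Y - m)` as a polynomial in `Y`. -/
noncomputable def dworkRatioPoly (p : ℕ) [Fact p.Prime] (m a b : ℕ) : ℤ_[p][X] :=
  C (Ring.inverse (unitRising p (p - 1) a b 1)) ^ 2 * unitRising p m a b (X - (m : ℤ_[p][X])) *
    unitRising p (p - 1 - m) a b (1 - (X - (m : ℤ_[p][X])))

theorem eval_dworkRatioPoly (m a b : ℕ) (Y : ℤ_[p]) :
    (dworkRatioPoly p m a b).eval Y = dworkRatio p m a b (Y - m) := by
  rw [← coe_evalRingHom, dworkRatioPoly, dworkRatio]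
  simp only [map_mul, map_pow, map_unitRising, map_sub, map_natCast, map_one, coe_evalRingHom,
    eval_X, eval_C]

theorem toZMod_unitRising_one (a b : ℕ) :
    PadicInt.toZMod (unitRising p (p - 1) a b (1 : ℤ_[p])) =
      (-1) ^ b * PadicInt.toZMod (unitRising p (p - 1) a 0 (1 : ℤ_[p])) := by
  have hpp := (Fact.out : p.Prime)
  have h1 : PadicInt.toZMod (1 : ℤ_[p]) = (0 : ZMod p) - ((p - 1 : ℕ) : ZMod p) := by
    rw [map_one, Nat.cast_sub hpp.one_le]; simp
  rw [map_unitRising, map_unitRising, h1, unitRising_algebra_zmod (Nat.sub_lt hpp.pos one_pos),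
    unitRising_algebra_zmod (Nat.sub_lt hpp.pos one_pos),
    zero_pow (Nat.sub_pos_of_lt hpp.one_lt).ne', zero_sub, pow_zero, one_mul]

theorem map_dworkRatioPoly {m : ℕ} (hm : m < p) (a b : ℕ) :
    (dworkRatioPoly p m a b).map PadicInt.toZMod =
      C (PadicInt.toZMod (unitRising p (p - 1) a b (1 : ℤ_[p])))⁻¹ ^ 2 *
        unitRising p m a b (X - (m : (ZMod p)[X])) *
        unitRising p (p - 1 - m) a b (-X - ((p - 1 - m : ℕ) : (ZMod p)[X])) := by
  have hY : (1 - (X - (m : (ZMod p)[X]))) = -X - ((p - 1 - m : ℕ) : (ZMod p)[X]) := by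
    have h0 : (p : (ZMod p)[X]) = 0 := CharP.cast_eq_zero _ p
    have h1 : ((p - 1 - m : ℕ) : (ZMod p)[X]) + 1 + m = p := by
      have : p - 1 - m + 1 + m = p := by omega
      exact_mod_cast congrArg (Nat.cast (R := (ZMod p)[X])) this
    linear_combination h1 + h0
  rw [← hY, ← coe_mapRingHom, dworkRatioPoly]
  simp only [map_mul, map_pow, map_unitRising, map_sub, map_natCast, map_one, coe_mapRingHom,
    map_X, map_C, PadicInt.toZMod_ringInverse]

/-- Both numerators contribute (X^(p-1) - 1)^b, the second one at -X because p - 1 is even; the sign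
(-1)^b of the denominator is squared away. -/
theorem map_dworkRatioPoly_eq_mul (hp : Odd p) {m : ℕ} (hm : m < p) (a b : ℕ) :
    (dworkRatioPoly p m a b).map PadicInt.toZMod =
      ((X ^ (p - 1) - 1) ^ 2) ^ b * (dworkRatioPoly p m a 0).map PadicInt.toZMod := by
  have hsq : (C (((-1 : ZMod p) ^ b)⁻¹)) ^ 2 = 1 := by
    rcases neg_one_pow_eq_or (ZMod p) b with h | h <;> simp [h]
  have hev : Even (p - 1) := by
    obtain ⟨k, hk⟩ := hp
    exact ⟨k, by omega⟩
  rw [map_dworkRatioPoly hm, map_dworkRatioPoly hm, unitRising_algebra_zmod hm,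
    unitRising_algebra_zmod hm, unitRising_algebra_zmod (by omega : p - 1 - m < p),
    unitRising_algebra_zmod (by omega : p - 1 - m < p), toZMod_unitRising_one a b, hev.neg_pow,
    mul_inv, C_mul, mul_pow, hsq, ← pow_mul, mul_comm 2 b, pow_mul]
  generalize (X ^ (p - 1) - 1 : (ZMod p)[X]) = Z
  ring

theorem dvd_sub_one_sq_pow_sub_one {A : Type*} [CommRing A] (Z : A) (b : ℕ) :
    Z ∣ ((Z - 1) ^ 2) ^ b - 1 := by
  have h1 : Z ∣ (Z - 1) ^ 2 - 1 := Dvd.intro (Z - 2) (by ring)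
  have h2 := sub_dvd_pow_sub_pow ((Z - 1) ^ 2) 1 b
  rw [one_pow] at h2
  exact h1.trans h2

theorem X_pow_dvd_map_dworkRatioPoly_sub (hp : Odd p) {m : ℕ} (hm : m < p) (a b : ℕ) :
    X ^ (p - 1) ∣ (dworkRatioPoly p m a b - dworkRatioPoly p m a 0).map PadicInt.toZMod := by
  rw [Polynomial.map_sub, map_dworkRatioPoly_eq_mul hp hm, ← sub_one_mul]
  refine Dvd.dvd.mul_right ?_ _
  exact dvd_sub_one_sq_pow_sub_one _ b

theorem dvd_coeff_dworkRatioPoly_sub (hp : 3 < p) {m : ℕ} (hm : m < p) (a b : ℕ) {i : ℕ}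
    (hi : i < 3) : (p : ℤ_[p]) ∣ (dworkRatioPoly p m a b - dworkRatioPoly p m a 0).coeff i := by
  have hodd : Odd p := (Fact.out : p.Prime).odd_of_ne_two (by omega)
  rw [← PadicInt.toZMod_eq_zero_iff_dvd, ← coeff_map]
  exact X_pow_dvd_iff.mp (X_pow_dvd_map_dworkRatioPoly_sub hodd hm a b) i (by omega)

/-- At pρ the quadratic term is p·c₂·(pρ)², and all higher terms contain (pρ)³. -/
theorem exists_affine_of_dvd_coeff {f : ℤ_[p][X]} (hf : ∀ i < 3, (p : ℤ_[p]) ∣ f.coeff i) :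
    ∃ c₀ c₁ : ℤ_[p], ∀ ρ, (p : ℤ_[p]) ^ 3 ∣ f.eval ((p : ℤ_[p]) * ρ) - p * (c₀ + p * ρ * c₁) := by
  obtain ⟨c₀, h₀⟩ := hf 0 (by omega)
  obtain ⟨c₁, h₁⟩ := hf 1 (by omega)
  obtain ⟨c₂, h₂⟩ := hf 2 (by omega)
  refine ⟨c₀, c₁, fun ρ => ⟨ρ ^ 2 * c₂ + ρ ^ 3 * f.divX.divX.divX.eval ((p : ℤ_[p]) * ρ), ?_⟩⟩
  rw [eval_eq_coeff_add_divX, eval_eq_coeff_add_divX f.divX, eval_eq_coeff_add_divX f.divX.divX]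
  simp only [coeff_divX, h₀, h₁, h₂, zero_add, Nat.reduceAdd]
  ring

/-- Since f already carries a factor p, only the affine part of g matters, and the mixed term in ρσ
is divisible by p³. -/
theorem exists_affine_mul_of_dvd_coeff {f : ℤ_[p][X]} (hf : ∀ i < 3, (p : ℤ_[p]) ∣ f.coeff i)
    (g : ℤ_[p][X]) : ∃ e₀ e₁ e₂ : ℤ_[p], ∀ ρ σ,
      (p : ℤ_[p]) ^ 3 ∣ f.eval ((p : ℤ_[p]) * ρ) * g.eval ((p : ℤ_[p]) * σ) -
        p * (e₀ + p * ρ * e₁ + p * σ * e₂) := by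
  obtain ⟨c₀, c₁, hc⟩ := exists_affine_of_dvd_coeff hf
  refine ⟨c₀ * g.coeff 0, c₁ * g.coeff 0, c₀ * g.divX.coeff 0, fun ρ σ => ?_⟩
  have hg : g.eval ((p : ℤ_[p]) * σ) = g.coeff 0 +
      p * σ * (g.divX.coeff 0 + p * σ * g.divX.divX.eval ((p : ℤ_[p]) * σ)) := by
    rw [eval_eq_coeff_add_divX, eval_eq_coeff_add_divX g.divX]
  obtain ⟨u, hu⟩ := hc ρ
  rw [sub_eq_iff_eq_add] at hu
  rw [hg, hu]
  refine ⟨u * (g.coeff 0 + p * σ * (g.divX.coeff 0 + p * σ * g.divX.divX.eval ((p : ℤ_[p]) * σ))) +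
    σ * ρ * c₁ * g.divX.coeff 0 + (c₀ + p * ρ * c₁) * σ ^ 2 * g.divX.divX.eval ((p : ℤ_[p]) * σ), ?_⟩
  ring

/-- The change of the sum over a block of `p` consecutive terms is affine modulo `p ^ 3` in the
images of the parameters under Dwork's operation. -/
theorem exists_affine_sum_dworkRatio_sub (hp : 3 < p) {m n : ℕ} (hm : m < p) (hn : n < p)
    (b : ℕ) : ∃ e₀ e₁ e₂ : ℤ_[p], ∀ ρ σ : ℤ_[p],
      (p : ℤ_[p]) ^ 3 ∣
        (∑ a ∈ Finset.range p, dworkRatio p m a b (p * ρ - m) * dworkRatio p n a b (p * σ - n) -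
          ∑ a ∈ Finset.range p, dworkRatio p m a 0 (p * ρ - m) * dworkRatio p n a 0 (p * σ - n)) -
        p * (e₀ + p * ρ * e₁ + p * σ * e₂) := by
  -- With subscript b or 0 for the block: u_b v_b - u_0 v_0 = (u_b - u_0) v_b + (v_b - v_0) u_0. The
  -- second product has ρ and σ exchanged, so d₁ and d₂ swap roles.
  choose c₀ c₁ c₂ hc using fun a => exists_affine_mul_of_dvd_coeff
    (fun i hi => dvd_coeff_dworkRatioPoly_sub hp hm a b hi) (dworkRatioPoly p n a b)
  choose d₀ d₁ d₂ hd using fun a => exists_affine_mul_of_dvd_coeff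
    (fun i hi => dvd_coeff_dworkRatioPoly_sub hp hn a b hi) (dworkRatioPoly p m a 0)
  refine ⟨∑ a ∈ Finset.range p, (c₀ a + d₀ a), ∑ a ∈ Finset.range p, (c₁ a + d₂ a),
    ∑ a ∈ Finset.range p, (c₂ a + d₁ a), fun ρ σ => ?_⟩
  rw [← Finset.sum_sub_distrib, Finset.mul_sum, Finset.mul_sum, ← Finset.sum_add_distrib,
    ← Finset.sum_add_distrib, Finset.mul_sum, ← Finset.sum_sub_distrib]
  refine Finset.dvd_sum fun a _ => ?_
  convert dvd_add (hc a ρ σ) (hd a σ ρ) using 1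
  simp only [eval_sub, eval_dworkRatioPoly]
  ring

end Interpolation

/-! ### Closed form of the ratio at the parameter -m -/

section ShiftedProducts

variable {R : Type*} [CommRing R]

/-- The product `(y + 1) (y + 2) ⋯ (y + m)`. -/
def prodAbove (m : ℕ) (y : R) : R := ∏ l ∈ Finset.range m, (y + 1 + (l : R))

/-- The product `(y - 1) (y - 2) ⋯ (y - m)`. -/
def prodBelow (m : ℕ) (y : R) : R := ∏ l ∈ Finset.range m, (y - 1 - (l : R))

theorem prodBelow_zero_right (m : ℕ) : prodBelow m (0 : R) = (-1) ^ m * prodAbove m 0 := by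
  rw [prodBelow, prodAbove, ← Finset.card_range m, ← Finset.prod_const, Finset.card_range,
    ← Finset.prod_mul_distrib]
  exact Finset.prod_congr rfl fun _ _ => by ring

theorem prodAbove_zero_right (m : ℕ) : prodAbove m (0 : R) = (m.factorial : R) := by
  rw [prodAbove, ← Finset.prod_range_add_one_eq_factorial]
  push_cast
  exact Finset.prod_congr rfl fun _ _ => by ring

theorem prodBelow_eq_prodAbove (m : ℕ) (y : R) : prodBelow m (y + m + 1) = prodAbove m y := by
  rw [prodBelow, prodAbove, ← Finset.prod_range_reflect]
  refine Finset.prod_congr rfl fun l hl => ?_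
  have : m - 1 - l + 1 + l = m := by have := Finset.mem_range.mp hl; omega
  have h := congrArg (Nat.cast (R := R)) this
  push_cast at h
  linear_combination -h

theorem prodBelow_add (m n : ℕ) (y : R) :
    prodBelow (m + n) y = prodBelow m y * prodBelow n (y - m) := by
  rw [prodBelow, Finset.prod_range_add, prodBelow, prodBelow]
  congr 1
  refine Finset.prod_congr rfl fun l _ => ?_
  push_cast
  ring

theorem prodAbove_add (m n : ℕ) (y : R) :
    prodAbove (m + n) y = prodAbove m y * prodAbove n (y + m) := by
  rw [prodAbove, Finset.prod_range_add, prodAbove, prodAbove]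
  congr 1
  refine Finset.prod_congr rfl fun l _ => ?_
  push_cast
  ring

theorem prod_erase_eq_prodBelow_mul {q m : ℕ} (hm : m < q) (y : R) :
    ∏ l ∈ (Finset.range q).erase m, (y - (m : R) + (l : R)) =
      prodBelow m y * prodAbove (q - 1 - m) y := by
  have hs : (Finset.range q).erase m =
      Finset.range m ∪ (Finset.range (q - 1 - m)).image (fun l => m + 1 + l) := by
    ext l
    simp only [Finset.mem_erase, Finset.mem_range, Finset.mem_union, Finset.mem_image]
    constructor
    · rintro ⟨h1, h2⟩
      by_cases h : l < m
      · exact Or.inl h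
      · exact Or.inr ⟨l - m - 1, by omega, by omega⟩
    · rintro (h | ⟨k, hk, rfl⟩) <;> omega
  rw [hs, Finset.prod_union, Finset.prod_image]
  · congr 1
    · rw [prodBelow, ← Finset.prod_range_reflect]
      refine Finset.prod_congr rfl fun l hl => ?_
      have : m - 1 - l + 1 + l = m := by have := Finset.mem_range.mp hl; omega
      have h := congrArg (Nat.cast (R := R)) this
      push_cast at h
      linear_combination h
    · rw [prodAbove]
      refine Finset.prod_congr rfl fun l _ => ?_
      push_cast
      ring
  · intro a _ b _ h
    simpa using h
  · rw [Finset.disjoint_left]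
    intro l hl
    simp only [Finset.mem_range, Finset.mem_image, not_exists, not_and] at hl ⊢
    intro k _
    omega

/-- The quotient of the numerators by the squared denominator telescopes over the blocks; the sign
comes from b = 0. Cross-multiplication avoids any invertibility. -/
theorem unitRising_mul_unitRising_neg {p m : ℕ} (hm : m < p) (b : ℕ) :
    unitRising p m 0 b (-(m : R)) * unitRising p (p - 1 - m) 0 b (1 + (m : R)) *
        prodBelow m ((p * b : ℕ) : R) =
      unitRising p (p - 1) 0 b (1 : R) ^ 2 * ((-1) ^ m * prodAbove m ((p * b : ℕ) : R)) := by
  obtain ⟨m', hm'⟩ : ∃ m', m' = p - 1 - m := ⟨_, rfl⟩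
  have hp : p = m + m' + 1 := by omega
  rw [← hm']
  have hpR : (p : R) = m + m' + 1 := by rw [hp]; push_cast; ring
  induction b with
  | zero => simp [unitRising, prodBelow_zero_right]
  | succ b ih =>
    have hU : ∏ l ∈ (Finset.range p).erase m, (-(m : R) + ((p * b + l : ℕ) : R)) =
        prodBelow m ((p * b : ℕ) : R) * prodAbove m' ((p * b : ℕ) : R) := by
      rw [hm', ← prod_erase_eq_prodBelow_mul hm]
      refine Finset.prod_congr rfl fun l _ => ?_
      push_cast
      ring
    have hV : ∏ l ∈ (Finset.range p).erase m', (1 + (m : R) + ((p * b + l : ℕ) : R)) =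
        prodBelow m' ((p * (b + 1) : ℕ) : R) * prodAbove m ((p * (b + 1) : ℕ) : R) := by
      have h := prod_erase_eq_prodBelow_mul (by omega : m' < p) ((p * (b + 1) : ℕ) : R)
      rw [show p - 1 - m' = m by omega] at h
      rw [← h]
      refine Finset.prod_congr rfl fun l _ => ?_
      push_cast
      linear_combination -hpR
    have hN : ∏ l ∈ (Finset.range p).erase (p - 1), (1 + ((p * b + l : ℕ) : R)) =
        prodBelow (p - 1) ((p * (b + 1) : ℕ) : R) := by
      have h := prod_erase_eq_prodBelow_mul (by omega : p - 1 < p) ((p * (b + 1) : ℕ) : R)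
      rw [Nat.sub_self, prodAbove, Finset.prod_range_zero, mul_one] at h
      rw [← h]
      refine Finset.prod_congr rfl fun l _ => ?_
      rw [show p - 1 = m + m' by omega]
      push_cast
      linear_combination -hpR
    -- The p - 1 integers strictly between pb and p(b+1) are cut in two ways: the top m and bottom
    -- m', or the top m' and bottom m.
    have h1 : prodBelow (p - 1) ((p * (b + 1) : ℕ) : R) =
        prodBelow m ((p * (b + 1) : ℕ) : R) * prodAbove m' ((p * b : ℕ) : R) := by
      rw [show p - 1 = m + m' by omega, prodBelow_add, ← prodBelow_eq_prodAbove]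
      congr 2
      push_cast
      linear_combination hpR
    have h2 : prodBelow (p - 1) ((p * (b + 1) : ℕ) : R) =
        prodBelow m' ((p * (b + 1) : ℕ) : R) * prodAbove m ((p * b : ℕ) : R) := by
      rw [show p - 1 = m' + m by omega, prodBelow_add, ← prodBelow_eq_prodAbove]
      congr 2
      push_cast
      linear_combination hpR
    simp only [unitRising, Finset.prod_range_zero, mul_one] at ih ⊢
    rw [Finset.prod_range_succ, Finset.prod_range_succ, Finset.prod_range_succ, hU, hV, hN]
    generalize prodBelow (p - 1) ((p * (b + 1) : ℕ) : R) = D at *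
    generalize ∏ j ∈ Finset.range b, ∏ l ∈ (Finset.range p).erase m,
      (-(m : R) + ((p * j + l : ℕ) : R)) = u at *
    generalize ∏ j ∈ Finset.range b, ∏ l ∈ (Finset.range p).erase m',
      (1 + (m : R) + ((p * j + l : ℕ) : R)) = v at *
    generalize ∏ j ∈ Finset.range b, ∏ l ∈ (Finset.range p).erase (p - 1),
      (1 + ((p * j + l : ℕ) : R)) = w at *
    generalize prodBelow m ((p * b : ℕ) : R) = x1 at *
    generalize prodAbove m ((p * b : ℕ) : R) = x2 at *
    generalize prodAbove m' ((p * b : ℕ) : R) = x3 at *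
    generalize prodBelow m ((p * (b + 1) : ℕ) : R) = y1 at *
    generalize prodAbove m ((p * (b + 1) : ℕ) : R) = y2 at *
    generalize prodBelow m' ((p * (b + 1) : ℕ) : R) = y3 at *
    subst h1
    linear_combination (y3 * y2 * x3 * y1) * ih - w ^ 2 * (-1) ^ m * y2 * (y1 * x3) * h2

theorem unitRising_eq_mul_prod (p m a b : ℕ) (y : R) :
    unitRising p m a b y = unitRising p m 0 b y * ∏ l ∈ Finset.range a, (y + ((p * b + l : ℕ) : R)) := by
  simp [unitRising]

/-- Each side is the product of x - m, …, x + a. This carries the closed form from pb to pb + a. -/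
theorem mul_prodBelow_mul_prod (m a : ℕ) (x : R) :
    (x + a) * prodBelow m (x + a) * ∏ l ∈ Finset.range a, (x + l - m) =
      x * prodBelow m x * prodAbove a x := by
  induction a with
  | zero => simp [prodAbove]
  | succ a ih =>
    have h1 := prodBelow_add 1 m (x + (a + 1 : ℕ))
    have h2 := prodBelow_add m 1 (x + (a + 1 : ℕ))
    have e : (x + (a + 1 : ℕ) - (1 : ℕ)) = x + a := by push_cast; ring
    have e' : prodBelow 1 (x + (a + 1 : ℕ)) = x + a := by
      simp only [prodBelow, Finset.prod_range_one]; push_cast; ring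
    have e'' : prodBelow 1 (x + (a + 1 : ℕ) - m) = x + a - m := by
      simp only [prodBelow, Finset.prod_range_one]; push_cast; ring
    rw [add_comm 1 m, h2, e', e, e''] at h1
    have h3 : prodAbove (a + 1) x = prodAbove a x * (x + 1 + a) := Finset.prod_range_succ _ _
    rw [Finset.prod_range_succ, h3, ← mul_assoc (x * prodBelow m x), ← ih]
    push_cast at h1 ⊢
    linear_combination (x + (a + 1)) * (∏ l ∈ Finset.range a, (x + l - m)) * h1

theorem prodAbove_mul_prod (m a : ℕ) (x : R) :
    prodAbove m (x + a) * prodAbove a x = prodAbove m x * prodAbove a (x + m) := by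
  rw [mul_comm, ← prodAbove_add, ← prodAbove_add, add_comm]

/-- With t = pb + a the ratio becomes pb times a proper rational function of t with simple poles 0,
…, m, ready for partial fractions. -/
theorem unitRising_mul_unitRising_neg_mul {p m : ℕ} (hm : m < p) (a b : ℕ) :
    unitRising p m a b (-(m : R)) * unitRising p (p - 1 - m) a b (1 + (m : R)) *
        (((p * b : ℕ) + a : R) * prodBelow m ((p * b : ℕ) + a : R)) =
      unitRising p (p - 1) a b (1 : R) ^ 2 *
        ((-1) ^ m * ((p * b : ℕ) : R) * prodAbove m ((p * b : ℕ) + a : R)) := by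
  rw [unitRising_eq_mul_prod p m, unitRising_eq_mul_prod p (p - 1 - m),
    unitRising_eq_mul_prod p (p - 1)]
  have h0 := unitRising_mul_unitRising_neg (R := R) hm b
  have h1 := mul_prodBelow_mul_prod m a ((p * b : ℕ) : R)
  have h2 := prodAbove_mul_prod m a ((p * b : ℕ) : R)
  have e1 : ∏ l ∈ Finset.range a, (-(m : R) + ((p * b + l : ℕ) : R)) =
      ∏ l ∈ Finset.range a, (((p * b : ℕ) : R) + l - m) :=
    Finset.prod_congr rfl fun l _ => by push_cast; ring
  have e2 : ∏ l ∈ Finset.range a, (1 + (m : R) + ((p * b + l : ℕ) : R)) =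
      prodAbove a (((p * b : ℕ) : R) + m) :=
    Finset.prod_congr rfl fun l _ => by push_cast; ring
  have e3 : ∏ l ∈ Finset.range a, (1 + ((p * b + l : ℕ) : R)) = prodAbove a ((p * b : ℕ) : R) :=
    Finset.prod_congr rfl fun l _ => by push_cast; ring
  rw [e1, e2, e3]
  generalize ((p * b : ℕ) : R) = x at *
  generalize unitRising p m 0 b (-(m : R)) = u at *
  generalize unitRising p (p - 1 - m) 0 b (1 + (m : R)) = v at *
  generalize unitRising p (p - 1) 0 b (1 : R) = w at *
  linear_combination (u * v * prodAbove a (x + m)) * h1 +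
    (x * prodAbove a x * prodAbove a (x + m)) * h0 - (w ^ 2 * (-1) ^ m * x * prodAbove a x) * h2

end ShiftedProducts

/-! ### Legendre coefficients, partial fractions and sums of inverses -/

/-- The coefficients of `₂F₁(-m, m + 1; 1; x)`. -/
def legendreCoeff (m k : ℕ) : ℤ := (-1) ^ k * m.choose k * (m + k).choose k

theorem legendreCoeff_eq_zero {m k : ℕ} (h : m < k) : legendreCoeff m k = 0 := by
  simp [legendreCoeff, Nat.choose_eq_zero_of_lt h]

theorem factorial_sq_mul_legendreCoeff (R : Type*) [CommRing R] (m k : ℕ) :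
    (k.factorial : R) ^ 2 * (legendreCoeff m k : R) =
      (∏ l ∈ Finset.range k, (-(m : R) + (l : R))) * ∏ l ∈ Finset.range k, (1 + (m : R) + (l : R)) := by
  have h1 : ∏ l ∈ Finset.range k, (1 + (m : R) + (l : R)) =
      (k.factorial : R) * ((m + k).choose k : R) := by
    have := Nat.ascFactorial_eq_factorial_mul_choose m k
    rw [Nat.ascFactorial_eq_prod_range] at this
    have h := congrArg (Nat.cast (R := R)) this
    push_cast at h
    rw [← h]
    exact Finset.prod_congr rfl fun _ _ => by ring
  have h2 : ∏ l ∈ Finset.range k, (-(m : R) + (l : R)) =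
      (-1) ^ k * ((k.factorial : R) * (m.choose k : R)) := by
    rw [← Nat.cast_mul, ← Nat.descFactorial_eq_factorial_mul_choose]
    clear h1
    induction k with
    | zero => simp
    | succ k ih =>
      rw [Finset.prod_range_succ, ih, Nat.descFactorial_succ, pow_succ, Nat.cast_mul]
      by_cases h : k ≤ m
      · rw [Nat.cast_sub h]; ring
      · simp [Nat.descFactorial_eq_zero_iff_lt.mpr (not_le.mp h)]
  rw [h1, h2, legendreCoeff]
  push_cast
  ring

-- Lagrange interpolation of (t+1)⋯(t+m), of degree m, at the m + 1 nodes 0, …, m. The residue at k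
-- is (-1)^(m-k) (m+k)!/(k!² (m-k)!), a Legendre coefficient up to (-1)^m.
open Polynomial in
theorem legendreCoeff_partialFraction {K : Type*} [Field K] [CharZero K] (m : ℕ) {t : K}
    (ht : ∀ k ≤ m, t ≠ (k : K)) :
    (-1) ^ m * prodAbove m t = (t * prodBelow m t) *
      ∑ k ∈ Finset.range (m + 1), (legendreCoeff m k : K) * (t - k)⁻¹ := by
  have hinj : Set.InjOn (fun k : ℕ => (k : K)) (Finset.range (m + 1)) :=
    fun _ _ _ _ h => Nat.cast_injective h
  have hdeg : (prodAbove m (X : K[X])).degree < (Finset.range (m + 1)).card := by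
    have h : prodAbove m (X : K[X]) = ∏ l ∈ Finset.range m, (X + C (1 + (l : K))) :=
      Finset.prod_congr rfl fun l _ => by simp [add_assoc]
    rw [h, degree_prod]
    simp only [degree_X_add_C, Finset.sum_const, Finset.card_range, nsmul_eq_mul, mul_one]
    exact_mod_cast Nat.lt_succ_self m
  have heval : ∀ y : K, (prodAbove m (X : K[X])).eval y = prodAbove m y := by
    intro y
    simp [prodAbove, eval_prod]
  have h := congrArg (eval t) (Lagrange.eq_interpolate hinj hdeg)
  rw [Lagrange.eval_interpolate_not_at_node] at h
  · have hnodal : eval t (Lagrange.nodal (Finset.range (m + 1)) fun k : ℕ => (k : K)) =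
        t * prodBelow m t := by
      rw [Lagrange.eval_nodal, Finset.prod_range_succ', prodBelow, mul_comm]
      simp [sub_sub, add_comm]
    rw [heval, hnodal] at h
    rw [h, mul_left_comm, Finset.mul_sum]
    congr 1
    refine Finset.sum_congr rfl fun k hk => ?_
    have hk' : k ≤ m := Nat.lt_succ_iff.mp (Finset.mem_range.mp hk)
    have hw : Lagrange.nodalWeight (Finset.range (m + 1)) (fun k : ℕ => (k : K)) k =
        ((-1 : K) ^ m * ((-1) ^ k * (k.factorial : K) * ((m - k).factorial : K)))⁻¹ := by
      rw [Lagrange.nodalWeight, Finset.prod_inv_distrib]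
      congr 1
      have h := prod_erase_eq_prodBelow_mul (Finset.mem_range.mp hk) (0 : K)
      rw [prodBelow_zero_right, prodAbove_zero_right, prodAbove_zero_right, Nat.add_sub_cancel] at h
      have hc : ((Finset.range (m + 1)).erase k).card = m := by
        rw [Finset.card_erase_of_mem hk, Finset.card_range, Nat.add_sub_cancel]
      rw [← h]
      nth_rewrite 2 [← hc]
      rw [← Finset.prod_const, ← Finset.prod_mul_distrib]
      exact Finset.prod_congr rfl fun _ _ => by ring
    have hf : prodAbove m (k : K) =
        (m + k).choose k * m.choose k * ((k.factorial : K) * (m - k).factorial) := by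
      refine mul_left_cancel₀ (Nat.cast_ne_zero.mpr k.factorial_ne_zero : (k.factorial : K) ≠ 0) ?_
      have h1 := prodAbove_add k m (0 : K)
      rw [prodAbove_zero_right, prodAbove_zero_right, zero_add] at h1
      have h2 := Nat.add_choose_mul_factorial_mul_factorial m k
      rw [← Nat.choose_mul_factorial_mul_factorial hk'] at h2
      have h3 := congrArg (Nat.cast (R := K)) h2
      push_cast at h3
      rw [← h1, add_comm k m, ← h3]
      ring
    have hk0 : (k.factorial : K) ≠ 0 := Nat.cast_ne_zero.mpr k.factorial_ne_zero
    have hmk0 : ((m - k).factorial : K) ≠ 0 := Nat.cast_ne_zero.mpr (m - k).factorial_ne_zero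
    have hs : ((-1 : K) ^ k)⁻¹ = (-1) ^ k := by
      rcases neg_one_pow_eq_or K k with h | h <;> simp [h]
    have hm1 : ((-1 : K) ^ m) * ((-1 : K) ^ m)⁻¹ = 1 := mul_inv_cancel₀ (by simp)
    rw [hw, heval, hf, legendreCoeff, mul_inv, mul_inv, mul_inv, hs]
    push_cast
    calc _ = ((-1 : K) ^ m * ((-1 : K) ^ m)⁻¹) * (k.factorial * (k.factorial : K)⁻¹) *
          ((m - k).factorial * ((m - k).factorial : K)⁻¹) *
          ((-1) ^ k * (m.choose k) * ((m + k).choose k) * (t - k)⁻¹) := by ring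
      _ = _ := by rw [hm1, mul_inv_cancel₀ hk0, mul_inv_cancel₀ hmk0]; ring
  · intro k hk
    exact ht k (Nat.lt_succ_iff.mp (Finset.mem_range.mp hk))

/-- Partial fractions reduce the sum to ∑ a⁻¹ = 0 when k ≠ l; for k = l it is ∑ a⁻² = 0, which needs
p > 3. -/
theorem ZMod.sum_inv_sub_mul_inv_sub {p : ℕ} [Fact p.Prime] (hp : 3 < p) (k l : ZMod p) :
    ∑ a : ZMod p, (a - k)⁻¹ * (a - l)⁻¹ = 2 * (k - l)⁻¹ ^ 2 := by
  have hsum : ∑ a : ZMod p, a⁻¹ = 0 := by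
    refine (Equiv.sum_comp (Equiv.inv (ZMod p)) fun a => a).trans ?_
    simpa using FiniteField.sum_pow_lt_card_sub_one (K := ZMod p) 1 (by rw [ZMod.card]; omega)
  have hshift : ∀ (g : ZMod p → ZMod p) (k : ZMod p), ∑ a, g (a - k) = ∑ a, g a :=
    fun g k => Equiv.sum_comp (Equiv.subRight k) g
  by_cases h : k = l
  · subst h
    rw [hshift fun a => a⁻¹ * a⁻¹]
    refine (Equiv.sum_comp (Equiv.inv (ZMod p)) fun a => a * a).trans ?_
    simpa [sq] using FiniteField.sum_pow_lt_card_sub_one (K := ZMod p) 2 (by rw [ZMod.card]; omega)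
  · have hkl : k - l ≠ 0 := sub_ne_zero.mpr h
    -- As 0⁻¹ = 0, the partial fraction identity fails at a = k and a = l, each time by (k-l)⁻²;
    -- these two corrections are the whole sum.
    have key : ∀ a : ZMod p, (a - k)⁻¹ * (a - l)⁻¹ = (k - l)⁻¹ * ((a - k)⁻¹ - (a - l)⁻¹) +
        (if a = k then (k - l)⁻¹ ^ 2 else 0) + (if a = l then (k - l)⁻¹ ^ 2 else 0) := by
      intro a
      by_cases hk : a = k
      · subst hk
        simp [h, sq]
      by_cases hl : a = l
      · subst hl
        have : (a - k)⁻¹ = -(k - a)⁻¹ := by rw [← inv_neg, neg_sub]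
        simp [hk, this, sq]
      · have h1 : a - k ≠ 0 := sub_ne_zero.mpr hk
        have h2 : a - l ≠ 0 := sub_ne_zero.mpr hl
        simp only [hk, hl, if_false, add_zero]
        field_simp
        ring
    simp only [key, Finset.sum_add_distrib, ← Finset.mul_sum, Finset.sum_sub_distrib,
      Finset.sum_ite_eq', Finset.mem_univ, if_true]
    rw [hshift fun a => a⁻¹, hshift fun a => a⁻¹, hsum]
    ring

theorem ZMod.sum_range_natCast {p : ℕ} [NeZero p] {M : Type*} [AddCommMonoid M] (f : ZMod p → M) :
    ∑ a ∈ Finset.range p, f a = ∑ c : ZMod p, f c :=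
  Finset.sum_bij' (fun a _ => (a : ZMod p)) (fun c _ => c.val) (fun _ _ => Finset.mem_univ _)
    (fun c _ => Finset.mem_range.mpr c.val_lt)
    (fun _ h => ZMod.val_cast_of_lt (Finset.mem_range.mp h)) (fun c _ => by simp) fun _ _ => rfl

/-! ### Block sums modulo p³ -/

section PadicSums

variable {p : ℕ} [Fact p.Prime]

theorem isUnit_natCast_add_sub {k a : ℕ} (hk : k < p) (ha : a < p) (hka : k ≠ a) (b : ℕ) :
    IsUnit (((p * b : ℕ) : ℤ_[p]) + a - k) := by
  have h : PadicInt.toZMod (((p * b : ℕ) : ℤ_[p]) + (a : ℤ_[p]) - (k : ℤ_[p])) =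
      (a : ZMod p) - (k : ZMod p) := by simp
  rw [PadicInt.isUnit_iff_toZMod_ne_zero, h, ne_eq, sub_eq_zero, ZMod.natCast_eq_natCast_iff', Nat.mod_eq_of_lt hk, Nat.mod_eq_of_lt ha]
  exact fun h => hka h.symm

theorem not_isUnit_natCast_mul (b : ℕ) : ¬ IsUnit ((p * b : ℕ) : ℤ_[p]) := by
  rw [PadicInt.isUnit_iff_toZMod_ne_zero, not_not]
  simp

/-- The two arguments add up to 2pb. For k = a both are the non-unit pb, whose `Ring.inverse` is 0.
-/
theorem ringInverse_add_ringInverse_neg {k a : ℕ} (hk : k < p) (ha : a < p) (b : ℕ) :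
    Ring.inverse (((p * b : ℕ) : ℤ_[p]) + a - k) + Ring.inverse (((p * b : ℕ) : ℤ_[p]) + k - a) =
      2 * ((p * b : ℕ) : ℤ_[p]) * (Ring.inverse (((p * b : ℕ) : ℤ_[p]) + a - k) *
        Ring.inverse (((p * b : ℕ) : ℤ_[p]) + k - a)) := by
  by_cases h : k = a
  · subst h
    simp only [add_sub_cancel_right]
    rw [Ring.inverse_non_unit _ (not_isUnit_natCast_mul b)]
    simp
  · have h1 := Ring.mul_inverse_cancel _ (isUnit_natCast_add_sub hk ha h b)
    have h2 := Ring.mul_inverse_cancel _ (isUnit_natCast_add_sub ha hk (Ne.symm h) b)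
    generalize Ring.inverse (((p * b : ℕ) : ℤ_[p]) + a - k) = u at *
    generalize Ring.inverse (((p * b : ℕ) : ℤ_[p]) + k - a) = v at *
    linear_combination -u * h2 - v * h1

theorem pow_three_dvd_sum_mul_sub (hp : 3 < p) (e f : ℕ → ℤ_[p]) (b : ℕ) :
    (p : ℤ_[p]) ^ 3 ∣
      ∑ a ∈ Finset.range p,
        (e a + ((p * b : ℕ) : ℤ_[p]) *
          ∑ k ∈ Finset.range p, e k * Ring.inverse (((p * b : ℕ) : ℤ_[p]) + a - k)) *
        (f a + ((p * b : ℕ) : ℤ_[p]) *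
          ∑ k ∈ Finset.range p, f k * Ring.inverse (((p * b : ℕ) : ℤ_[p]) + a - k)) -
      ∑ a ∈ Finset.range p, e a * f a := by
  set x : ℤ_[p] := ((p * b : ℕ) : ℤ_[p]) with hx
  set J : ℕ → ℕ → ℤ_[p] := fun a k => Ring.inverse (x + a - k) with hJ
  -- After exchanging a and k in the second half, the linear term pairs J a k with J k a and gains a
  -- further factor x.
  have hlin : ∑ a ∈ Finset.range p, ∑ k ∈ Finset.range p, (e a * (f k * J a k) + f a * (e k * J a k)) =
      2 * x * ∑ a ∈ Finset.range p, ∑ k ∈ Finset.range p, e a * f k * (J a k * J k a) := by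
    simp_rw [Finset.sum_add_distrib]
    rw [Finset.sum_comm (f := fun a k => f a * (e k * J a k)), ← Finset.sum_add_distrib,
      Finset.mul_sum]
    refine Finset.sum_congr rfl fun a ha => ?_
    rw [← Finset.sum_add_distrib, Finset.mul_sum]
    refine Finset.sum_congr rfl fun k hk => ?_
    have := ringInverse_add_ringInverse_neg (Finset.mem_range.mp hk) (Finset.mem_range.mp ha) b
    change J a k + J k a = 2 * x * (J a k * J k a) at this
    linear_combination e a * f k * this
  have hS : ∑ a ∈ Finset.range p, (e a + x * ∑ k ∈ Finset.range p, e k * J a k) *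
        (f a + x * ∑ k ∈ Finset.range p, f k * J a k) - ∑ a ∈ Finset.range p, e a * f a =
      x ^ 2 * (2 * (∑ a ∈ Finset.range p, ∑ k ∈ Finset.range p, e a * f k * (J a k * J k a)) +
        ∑ a ∈ Finset.range p, (∑ k ∈ Finset.range p, e k * J a k) *
          ∑ k ∈ Finset.range p, f k * J a k) := by
    have : ∀ a, (e a + x * ∑ k ∈ Finset.range p, e k * J a k) *
        (f a + x * ∑ k ∈ Finset.range p, f k * J a k) = e a * f a +
        x * (∑ k ∈ Finset.range p, (e a * (f k * J a k) + f a * (e k * J a k))) +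
        x ^ 2 * ((∑ k ∈ Finset.range p, e k * J a k) * ∑ k ∈ Finset.range p, f k * J a k) := by
      intro a
      rw [Finset.sum_add_distrib, ← Finset.mul_sum, ← Finset.mul_sum]
      ring
    rw [Finset.sum_congr rfl fun a _ => this a, Finset.sum_add_distrib, Finset.sum_add_distrib,
      ← Finset.mul_sum, ← Finset.mul_sum, hlin]
    ring
  rw [hS]
  have hx2 : (p : ℤ_[p]) ^ 2 ∣ x ^ 2 := pow_dvd_pow_of_dvd (Dvd.intro (b : ℤ_[p]) (by rw [hx]; push_cast; rfl)) 2
  rw [pow_succ]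
  refine mul_dvd_mul hx2 ?_
  rw [← PadicInt.toZMod_eq_zero_iff_dvd]
  have hJz : ∀ a k, PadicInt.toZMod (J a k) = ((a : ZMod p) - k)⁻¹ := by
    intro a k
    simp only [hJ, hx, PadicInt.toZMod_ringInverse]
    simp
  simp only [map_add, map_mul, map_sum, hJz, map_ofNat]
  -- Modulo p, J a k · J k a is -(a-k)⁻², so twice its sum cancels the sum computed here.
  have hT : ∑ a ∈ Finset.range p,
      (∑ k ∈ Finset.range p, PadicInt.toZMod (e k) * ((a : ZMod p) - k)⁻¹) *
        ∑ k ∈ Finset.range p, PadicInt.toZMod (f k) * ((a : ZMod p) - k)⁻¹ =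
      ∑ k ∈ Finset.range p, ∑ l ∈ Finset.range p, PadicInt.toZMod (e k) * PadicInt.toZMod (f l) *
        (2 * ((k : ZMod p) - l)⁻¹ ^ 2) := by
    simp_rw [Finset.sum_mul_sum]
    rw [Finset.sum_comm]
    refine Finset.sum_congr rfl fun k _ => ?_
    rw [Finset.sum_comm]
    refine Finset.sum_congr rfl fun l _ => ?_
    rw [← ZMod.sum_inv_sub_mul_inv_sub hp, ← ZMod.sum_range_natCast, Finset.mul_sum]
    exact Finset.sum_congr rfl fun a _ => by ring
  rw [hT, Finset.mul_sum, ← Finset.sum_add_distrib]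
  refine Finset.sum_eq_zero fun k _ => ?_
  rw [Finset.mul_sum, ← Finset.sum_add_distrib]
  refine Finset.sum_eq_zero fun l _ => ?_
  have : ((l : ZMod p) - k)⁻¹ = -((k : ZMod p) - l)⁻¹ := by rw [← inv_neg, neg_sub]
  rw [this]
  ring

theorem dworkRatio_neg_zero {m a : ℕ} (ha : a < p) :
    dworkRatio p m a 0 (-(m : ℤ_[p])) = legendreCoeff m a := by
  have h := factorial_sq_mul_legendreCoeff ℤ_[p] m a
  have hN := factorial_eq_unitRising ℤ_[p] (Fact.out : p.Prime).pos a 0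
  simp only [mul_zero, zero_add, pow_zero, Nat.factorial_zero, Nat.cast_one, one_mul] at hN
  have hu := isUnit_unitRising_one ha 0
  rw [← hN] at hu
  have hc := Ring.inverse_mul_cancel _ hu
  rw [dworkRatio, ← hN]
  have h1 : unitRising p m a 0 (-(m : ℤ_[p])) = ∏ l ∈ Finset.range a, (-(m : ℤ_[p]) + (l : ℤ_[p])) := by
    simp [unitRising]
  have h2 : unitRising p (p - 1 - m) a 0 (1 - -(m : ℤ_[p])) =
      ∏ l ∈ Finset.range a, (1 + (m : ℤ_[p]) + (l : ℤ_[p])) := by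
    simp [unitRising]
  rw [h1, h2, mul_assoc, ← h, ← mul_assoc, ← mul_pow, hc, one_pow, one_mul]

theorem PadicInt.coe_ringInverse {x : ℤ_[p]} (h : IsUnit x) :
    ((Ring.inverse x : ℤ_[p]) : ℚ_[p]) = (x : ℚ_[p])⁻¹ := by
  refine eq_inv_of_mul_eq_one_left ?_
  rw [← PadicInt.coe_mul, Ring.inverse_mul_cancel _ h, PadicInt.coe_one]

/-- The partial fraction is taken in ℚ_p, where t = pb + a ≥ p avoids the poles 0, …, m. Its term k
= a is pb · e_a/(pb) = e_a; in the remaining sum that index contributes 0 by the convention for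
`Ring.inverse`. -/
theorem dworkRatio_neg_eq {m a b : ℕ} (hm : m < p) (ha : a < p) (hb : 0 < b) :
    dworkRatio p m a b (-(m : ℤ_[p])) = legendreCoeff m a + ((p * b : ℕ) : ℤ_[p]) *
      ∑ k ∈ Finset.range p,
        (legendreCoeff m k : ℤ_[p]) * Ring.inverse (((p * b : ℕ) : ℤ_[p]) + a - k) := by
  have hN := isUnit_unitRising_one (p := p) ha b
  have hlt : p ≤ p * b := Nat.le_mul_of_pos_right p hb
  have hkey := unitRising_mul_unitRising_neg_mul (R := ℤ_[p]) hm a b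
  have hcancel : dworkRatio p m a b (-(m : ℤ_[p])) *
      (((p * b : ℕ) + a : ℤ_[p]) * prodBelow m ((p * b : ℕ) + a : ℤ_[p])) =
      (-1) ^ m * ((p * b : ℕ) : ℤ_[p]) * prodAbove m ((p * b : ℕ) + a : ℤ_[p]) := by
    have hc := Ring.inverse_mul_cancel _ hN
    rw [dworkRatio, sub_neg_eq_add]
    rw [mul_assoc, mul_assoc, ← mul_assoc (unitRising p m a b _), hkey, ← mul_assoc, ← mul_pow, hc,
      one_pow, one_mul]
  have ht : ∀ k ≤ m, (((p * b + a : ℕ)) : ℚ_[p]) ≠ (k : ℚ_[p]) := by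
    intro k hk h
    have := Nat.cast_injective h
    omega
  have hq := legendreCoeff_partialFraction m ht
  have hcoe := congrArg (PadicInt.Coe.ringHom (p := p)) hcancel
  have hpa : ∀ y : ℤ_[p], PadicInt.Coe.ringHom (prodAbove m y) = prodAbove m (y : ℚ_[p]) := by
    intro y; simp [prodAbove, map_prod]; rfl
  have hpb : ∀ y : ℤ_[p], PadicInt.Coe.ringHom (prodBelow m y) = prodBelow m (y : ℚ_[p]) := by
    intro y; simp [prodBelow, map_prod]; rfl
  have hT : (((p * b : ℕ) + a : ℤ_[p]) : ℚ_[p]) = ((p * b + a : ℕ) : ℚ_[p]) := by push_cast; rfl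
  have hx : (((p * b : ℕ) : ℤ_[p]) : ℚ_[p]) = ((p * b : ℕ) : ℚ_[p]) := by push_cast; rfl
  have hcoe' : (dworkRatio p m a b (-(m : ℤ_[p])) : ℚ_[p]) *
      (((p * b + a : ℕ) : ℚ_[p]) * prodBelow m ((p * b + a : ℕ) : ℚ_[p])) =
      (-1) ^ m * ((p * b : ℕ) : ℚ_[p]) * prodAbove m ((p * b + a : ℕ) : ℚ_[p]) := by
    simp only [map_mul, hpa, hpb, map_pow, map_neg, map_one] at hcoe
    have hc : ∀ y : ℤ_[p], PadicInt.Coe.ringHom y = (y : ℚ_[p]) := fun _ => rfl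
    simpa only [hc, hT, hx] using hcoe
  have hne : ((p * b + a : ℕ) : ℚ_[p]) * prodBelow m ((p * b + a : ℕ) : ℚ_[p]) ≠ 0 := by
    refine mul_ne_zero (by simpa using ht 0 m.zero_le) (Finset.prod_ne_zero_iff.mpr fun l hl => ?_)
    rw [sub_sub, sub_ne_zero]
    have := ht (1 + l) (by have := Finset.mem_range.mp hl; omega)
    exact_mod_cast this
  have hratio : (dworkRatio p m a b (-(m : ℤ_[p])) : ℚ_[p]) = ((p * b : ℕ) : ℚ_[p]) *
      ∑ k ∈ Finset.range p, (legendreCoeff m k : ℚ_[p]) * (((p * b + a : ℕ) : ℚ_[p]) - k)⁻¹ := by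
    rw [← Finset.sum_subset (Finset.range_subset_range.mpr (by omega : m + 1 ≤ p))]
    · refine mul_right_cancel₀ hne ?_
      rw [hcoe', mul_right_comm, hq]
      ring
    · intro k _ hk
      rw [legendreCoeff_eq_zero (by have := Finset.mem_range.not.mp hk; omega)]
      simp
  have hp0 : ((p * b : ℕ) : ℚ_[p]) ≠ 0 :=
    Nat.cast_ne_zero.mpr (Nat.mul_pos (Fact.out : p.Prime).pos hb).ne'
  have hterm : ∀ k ∈ Finset.range p, ((p * b : ℕ) : ℚ_[p]) *
      ((legendreCoeff m k : ℚ_[p]) * (((p * b + a : ℕ) : ℚ_[p]) - k)⁻¹) =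
      (if k = a then (legendreCoeff m k : ℚ_[p]) else 0) + ((p * b : ℕ) : ℚ_[p]) *
        ((legendreCoeff m k : ℚ_[p]) *
          ((Ring.inverse (((p * b : ℕ) : ℤ_[p]) + a - k) : ℤ_[p]) : ℚ_[p])) := by
    intro k hk
    by_cases h : k = a
    · subst h
      rw [add_sub_cancel_right, Ring.inverse_non_unit _ (not_isUnit_natCast_mul b), if_pos rfl,
        Nat.cast_add, add_sub_cancel_right, PadicInt.coe_zero, mul_zero, mul_zero, add_zero,
        mul_left_comm, mul_inv_cancel₀ hp0, mul_one]
    · rw [if_neg h, zero_add,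
        PadicInt.coe_ringInverse (isUnit_natCast_add_sub (Finset.mem_range.mp hk) ha h b),
        PadicInt.coe_sub, hT, PadicInt.coe_natCast]
  refine Subtype.ext ?_
  rw [hratio, Finset.mul_sum, Finset.sum_congr rfl hterm, Finset.sum_add_distrib,
    Finset.sum_ite_eq', if_pos (Finset.mem_range.mpr ha), ← Finset.mul_sum]
  simp only [PadicInt.coe_add, PadicInt.coe_mul, PadicInt.coe_sum, PadicInt.coe_intCast, hx]

theorem pow_three_dvd_sum_dworkRatio_neg_sub (hp : 3 < p) {m n : ℕ} (hm : m < p) (hn : n < p)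
    (b : ℕ) : (p : ℤ_[p]) ^ 3 ∣
      ∑ a ∈ Finset.range p, dworkRatio p m a b (-m) * dworkRatio p n a b (-n) -
        ∑ a ∈ Finset.range p, dworkRatio p m a 0 (-m) * dworkRatio p n a 0 (-n) := by
  rcases Nat.eq_zero_or_pos b with rfl | hb
  · simp
  convert pow_three_dvd_sum_mul_sub hp (fun k => (legendreCoeff m k : ℤ_[p]))
    (fun k => (legendreCoeff n k : ℤ_[p])) b using 2
  · refine Finset.sum_congr rfl fun a ha => ?_
    rw [dworkRatio_neg_eq hm (Finset.mem_range.mp ha) hb,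
      dworkRatio_neg_eq hn (Finset.mem_range.mp ha) hb]
  · refine Finset.sum_congr rfl fun a ha => ?_
    rw [dworkRatio_neg_zero (Finset.mem_range.mp ha), dworkRatio_neg_zero (Finset.mem_range.mp ha)]

theorem dworkRatio_one_sub {m : ℕ} (hm : m < p) (a b : ℕ) (y : ℤ_[p]) :
    dworkRatio p (p - 1 - m) a b (1 - y) = dworkRatio p m a b y := by
  rw [dworkRatio, dworkRatio, show p - 1 - (p - 1 - m) = m by omega, sub_sub_cancel]
  ring

theorem dworkRatio_sub {m : ℕ} (hm : m < p) (a b : ℕ) :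
    dworkRatio p m a b (p - m) = dworkRatio p (p - 1 - m) a b (-((p - 1 - m : ℕ) : ℤ_[p])) := by
  rw [← dworkRatio_one_sub hm]
  congr 1
  have : p - 1 - m + 1 + m = p := by omega
  have h := congrArg (Nat.cast (R := ℤ_[p])) this
  push_cast at h
  linear_combination h

/-- The sum over a block of `p` consecutive terms does not depend on the block modulo `p ^ 3`. -/
theorem pow_three_dvd_sum_dworkRatio_sub (hp : 3 < p) {m n : ℕ} (hm : m < p) (hn : n < p)
    (b : ℕ) (ρ σ : ℤ_[p]) : (p : ℤ_[p]) ^ 3 ∣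
      ∑ a ∈ Finset.range p, dworkRatio p m a b (p * ρ - m) * dworkRatio p n a b (p * σ - n) -
        ∑ a ∈ Finset.range p, dworkRatio p m a 0 (p * ρ - m) * dworkRatio p n a 0 (p * σ - n) := by
  obtain ⟨e₀, e₁, e₂, h⟩ := exists_affine_sum_dworkRatio_sub hp hm hn b
  -- At ρ = 1 the parameter p - m is 1 - (-(p-1-m)), so reflection replaces m by p - 1 - m and ρ by
  -- 0; likewise for σ.
  have h00 := h 0 0
  have h10 := h 1 0
  have h01 := h 0 1
  simp only [mul_zero, zero_sub, mul_one, zero_mul, add_zero, dworkRatio_sub hm,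
    dworkRatio_sub hn] at h00 h10 h01
  have g00 := pow_three_dvd_sum_dworkRatio_neg_sub hp hm hn b
  have g10 := pow_three_dvd_sum_dworkRatio_neg_sub hp (by omega : p - 1 - m < p) hn b
  have g01 := pow_three_dvd_sum_dworkRatio_neg_sub hp hm (by omega : p - 1 - n < p) b
  have k00 := (dvd_iff_dvd_of_dvd_sub h00).mp g00
  have k10 := (dvd_iff_dvd_of_dvd_sub h10).mp g10
  have k01 := (dvd_iff_dvd_of_dvd_sub h01).mp g01
  refine (dvd_iff_dvd_of_dvd_sub (h ρ σ)).mpr ?_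
  -- An affine function is recovered from its three values with weights 1 - ρ - σ, ρ, σ.
  have := dvd_add (dvd_add (k00.mul_left (1 - ρ - σ)) (k10.mul_left ρ)) (k01.mul_left σ)
  convert this using 1
  ring

end PadicSums

/-! ### Coefficients of the series and the dash operation -/

section Coefficients

variable {p : ℕ} [Fact p.Prime]

/-- The coefficients `(r)_k (1 - r)_k / k! ^ 2`. -/
noncomputable def reflectionCoeff (r : ℤ_[p]) (k : ℕ) : ℤ_[p] :=
  Ring.multichoose r k * Ring.multichoose (1 - r) k

/-- Defining the coefficients by `Ring.multichoose` makes them p-adic integers; this identity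
determines them, as k! ≠ 0 in ℤ_p. -/
theorem factorial_mul_multichoose (r : ℤ_[p]) (k : ℕ) :
    (k.factorial : ℤ_[p]) * Ring.multichoose r k = ∏ i ∈ Finset.range k, (r + (i : ℤ_[p])) := by
  rw [← nsmul_eq_mul, Ring.factorial_nsmul_multichoose_eq_ascPochhammer,
    Polynomial.ascPochhammer_smeval_eq_eval]
  induction k with
  | zero => simp
  | succ k ih => rw [ascPochhammer_succ_eval, ih, Finset.prod_range_succ]

theorem factorial_sq_mul_reflectionCoeff (r : ℤ_[p]) (k : ℕ) :
    (k.factorial : ℤ_[p]) ^ 2 * reflectionCoeff r k =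
      (∏ i ∈ Finset.range k, (r + (i : ℤ_[p]))) * ∏ i ∈ Finset.range k, (1 - r + (i : ℤ_[p])) := by
  rw [← factorial_mul_multichoose, ← factorial_mul_multichoose, reflectionCoeff]
  ring

theorem reflectionCoeff_zero (r : ℤ_[p]) : reflectionCoeff r 0 = 1 := by
  simpa using factorial_sq_mul_reflectionCoeff r 0

/-- The two numerators yield p^b each, matching the p^(2b) in the squared factorial. -/
theorem reflectionCoeff_mul_add {m a : ℕ} (hm : m < p) (ha : a < p) (b : ℕ) {r ρ : ℤ_[p]}
    (h : r + m = p * ρ) :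
    reflectionCoeff r (p * b + a) = reflectionCoeff ρ b * dworkRatio p m a b r := by
  have hpp := (Fact.out : p.Prime)
  have h' : (1 - r) + ((p - 1 - m : ℕ) : ℤ_[p]) = p * (1 - ρ) := by
    have h1 : p - 1 - m + 1 + m = p := by omega
    have h2 := congrArg (Nat.cast (R := ℤ_[p])) h1
    push_cast at h2
    linear_combination h2 - h
  have hfac := factorial_sq_mul_reflectionCoeff r (p * b + a)
  have hfac' := factorial_sq_mul_reflectionCoeff ρ b
  rw [prod_range_add_eq_unitRising hm a b h,
    prod_range_add_eq_unitRising (by omega : p - 1 - m < p) a b h'] at hfac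
  have hN := factorial_eq_unitRising ℤ_[p] hpp.pos a b
  have hc := Ring.mul_inverse_cancel _ (isUnit_unitRising_one (p := p) ha b)
  have hne : ((p * b + a).factorial : ℤ_[p]) ^ 2 ≠ 0 :=
    pow_ne_zero _ (Nat.cast_ne_zero.mpr (Nat.factorial_ne_zero _))
  refine mul_left_cancel₀ hne ?_
  rw [hfac, hN, dworkRatio]
  generalize unitRising p (p - 1) a b (1 : ℤ_[p]) = N at *
  calc _ = (p : ℤ_[p]) ^ b * (p : ℤ_[p]) ^ b * unitRising p m a b r *
        unitRising p (p - 1 - m) a b (1 - r) * ((∏ i ∈ Finset.range b, (ρ + (i : ℤ_[p]))) *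
          ∏ i ∈ Finset.range b, (1 - ρ + (i : ℤ_[p]))) * 1 ^ 2 := by ring
    _ = _ := by
      rw [← hfac', ← hc]
      ring

theorem exists_firstDigit_neg {r : ℚ} {R : ℤ_[p]} (hR : (R : ℚ_[p]) = (r : ℚ_[p])) :
    ∃ (m : ℕ) (ρ : ℤ_[p]), m < p ∧ R + m = p * ρ ∧ ((dworkDash p r : ℚ) : ℚ_[p]) = ρ ∧
      ((dworkDash p (1 - r) : ℚ) : ℚ_[p]) = (1 - ρ : ℤ_[p]) := by
  have hp := (Fact.out : p.Prime)
  have hp0 : (p : ℚ_[p]) ≠ 0 := Nat.cast_ne_zero.mpr hp.ne_zero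
  have hfd : ∀ (x : ℚ) (X : ℤ_[p]), (X : ℚ_[p]) = (x : ℚ_[p]) → firstDigit p x = X.zmodRepr := by
    intro x X hX
    have hx : ‖(x : ℚ_[p])‖ ≤ 1 := hX ▸ X.2
    rw [firstDigit, dif_pos hx]
    exact congrArg _ (Subtype.ext hX.symm)
  have h1 := hfd (-r) (-R) (by push_cast; rw [hR])
  have h2 := hfd (-(1 - r)) (-(1 - R)) (by push_cast; rw [hR])
  obtain ⟨hlt, hmem⟩ := PadicInt.zmodRepr_spec (-R)
  set m := (-R).zmodRepr with hm
  rw [PadicInt.maximalIdeal_eq_span_p, Ideal.mem_span_singleton] at hmem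
  obtain ⟨σ, hσ⟩ := hmem
  have hρ : R + m = p * (-σ) := by linear_combination -hσ
  have hcast : ((p - 1 - m : ℕ) : ℤ_[p]) = p - 1 - m := by
    have h1 : p - 1 - m + 1 + m = p := by omega
    have h2 := congrArg (Nat.cast (R := ℤ_[p])) h1
    push_cast at h2
    linear_combination h2
  -- The digits for r and 1 - r add up to p - 1, which gives (1 - r)' = 1 - r'.
  have h3 : (-(1 - R)).zmodRepr = p - 1 - m := by
    refine PadicInt.zmodRepr_unique _ _ (by omega) ?_
    rw [PadicInt.maximalIdeal_eq_span_p, Ideal.mem_span_singleton, hcast]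
    exact Dvd.intro (-σ - 1) (by linear_combination -hρ)
  refine ⟨m, -σ, hlt, hρ, ?_, ?_⟩
  · rw [dworkDash, h1]
    push_cast
    rw [← hR, div_eq_iff hp0]
    have := congrArg (fun z : ℤ_[p] => (z : ℚ_[p])) hρ
    push_cast at this
    linear_combination this
  · rw [dworkDash, h2, h3]
    have := congrArg (fun z : ℤ_[p] => (z : ℚ_[p])) hρ
    have hc := congrArg (fun z : ℤ_[p] => (z : ℚ_[p])) hcast
    push_cast at this hc ⊢
    rw [← hR, div_eq_iff hp0]
    linear_combination hc - this

theorem cast_risingFactorial {r : ℚ} {R : ℤ_[p]} (hR : (r : ℚ_[p]) = (R : ℚ_[p])) (k : ℕ) :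
    ((risingFactorial r k : ℚ) : ℚ_[p]) = (∏ i ∈ Finset.range k, (R + (i : ℤ_[p])) : ℤ_[p]) := by
  rw [risingFactorial, Rat.cast_prod]
  refine Eq.trans ?_ (map_prod (PadicInt.Coe.ringHom (p := p)) _ _).symm
  change _ = ∏ i ∈ Finset.range k, ((R + (i : ℤ_[p]) : ℤ_[p]) : ℚ_[p])
  refine Finset.prod_congr rfl fun i _ => ?_
  push_cast
  rw [hR]

/-- The four rationals are left arbitrary so that this applies both to α and to its image under the
dash. -/
theorem cast_prod_map_risingFactorial {x₁ y₁ x₂ y₂ : ℚ} {R₁ R₂ : ℤ_[p]}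
    (hx₁ : (x₁ : ℚ_[p]) = (R₁ : ℚ_[p])) (hy₁ : (y₁ : ℚ_[p]) = ((1 - R₁ : ℤ_[p]) : ℚ_[p]))
    (hx₂ : (x₂ : ℚ_[p]) = (R₂ : ℚ_[p])) (hy₂ : (y₂ : ℚ_[p]) = ((1 - R₂ : ℤ_[p]) : ℚ_[p])) (k : ℕ) :
    (((({x₁, y₁, x₂, y₂} : Multiset ℚ).map fun a => risingFactorial a k).prod : ℚ) : ℚ_[p]) =
      ((k.factorial ^ 4 * (reflectionCoeff R₁ k * reflectionCoeff R₂ k) : ℤ_[p]) : ℚ_[p]) := by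
  have h : (k.factorial ^ 4 * (reflectionCoeff R₁ k * reflectionCoeff R₂ k) : ℤ_[p]) =
      (∏ i ∈ Finset.range k, (R₁ + (i : ℤ_[p]))) * ((∏ i ∈ Finset.range k, (1 - R₁ + (i : ℤ_[p]))) *
      ((∏ i ∈ Finset.range k, (R₂ + (i : ℤ_[p]))) *
        ∏ i ∈ Finset.range k, (1 - R₂ + (i : ℤ_[p])))) := by
    linear_combination (k.factorial ^ 2 * reflectionCoeff R₂ k : ℤ_[p]) *
      factorial_sq_mul_reflectionCoeff R₁ k + (∏ i ∈ Finset.range k, (R₁ + (i : ℤ_[p]))) *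
      (∏ i ∈ Finset.range k, (1 - R₁ + (i : ℤ_[p]))) * factorial_sq_mul_reflectionCoeff R₂ k
  rw [h]
  simp only [Multiset.insert_eq_cons, Multiset.map_cons, Multiset.prod_cons,
    Multiset.map_singleton, Multiset.prod_singleton, Rat.cast_mul, cast_risingFactorial hx₁,
    cast_risingFactorial hy₁, cast_risingFactorial hx₂, cast_risingFactorial hy₂, PadicInt.coe_mul]

theorem risingFactorial_one (k : ℕ) : risingFactorial 1 k = (k.factorial : ℚ) := by
  rw [risingFactorial, ← Finset.prod_range_add_one_eq_factorial]
  push_cast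
  exact Finset.prod_congr rfl fun _ _ => add_comm _ _

theorem cast_dworkTrunc {r₁ r₂ : ℚ} {R₁ R₂ : ℤ_[p]} (h₁ : (R₁ : ℚ_[p]) = (r₁ : ℚ_[p]))
    (h₂ : (R₂ : ℚ_[p]) = (r₂ : ℚ_[p])) (s : ℕ) :
    ((dworkTrunc p ({r₁, 1 - r₁, r₂, 1 - r₂} : Multiset ℚ) s : ℚ) : ℚ_[p]) =
      ((∑ k ∈ Finset.range (p ^ s), reflectionCoeff R₁ k * reflectionCoeff R₂ k : ℤ_[p]) :
        ℚ_[p]) := by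
  rw [dworkTrunc, truncHyp, Nat.sub_add_cancel (Nat.one_le_pow _ _ (Fact.out : p.Prime).pos),
    Rat.cast_sum, PadicInt.coe_sum]
  refine Finset.sum_congr rfl fun k _ => ?_
  have h := cast_prod_map_risingFactorial h₁.symm (y₁ := 1 - r₁) (by push_cast; rw [h₁]) h₂.symm
    (y₂ := 1 - r₂) (by push_cast; rw [h₂]) k
  have hk : (k.factorial : ℚ_[p]) ≠ 0 := Nat.cast_ne_zero.mpr k.factorial_ne_zero
  have hden : ((({1, 1, 1} : Multiset ℚ).map fun b => risingFactorial b k).prod) =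
      (k.factorial : ℚ) ^ 3 := by
    simp only [Multiset.insert_eq_cons, Multiset.map_cons, Multiset.prod_cons,
      Multiset.map_singleton, Multiset.prod_singleton, risingFactorial_one]
    ring
  rw [one_pow, mul_one, hden, Rat.cast_div, h]
  push_cast
  rw [div_eq_iff (by positivity)]
  ring

theorem pow_three_dvd_sum_reflectionCoeff_sub (hp : 3 < p) {m n : ℕ} (hm : m < p) (hn : n < p)
    {R₁ R₂ ρ₁ ρ₂ : ℤ_[p]} (h₁ : R₁ + m = p * ρ₁) (h₂ : R₂ + n = p * ρ₂)
    (hclosed : ∀ k, reflectionCoeff ρ₁ k * reflectionCoeff ρ₂ k =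
      reflectionCoeff R₁ k * reflectionCoeff R₂ k) (N : ℕ) :
    (p : ℤ_[p]) ^ 3 ∣
      ∑ k ∈ Finset.range (p * N), reflectionCoeff R₁ k * reflectionCoeff R₂ k -
        (∑ k ∈ Finset.range N, reflectionCoeff R₁ k * reflectionCoeff R₂ k) *
          ∑ k ∈ Finset.range p, reflectionCoeff R₁ k * reflectionCoeff R₂ k := by
  have hR₁ : R₁ = p * ρ₁ - m := by linear_combination h₁
  have hR₂ : R₂ = p * ρ₂ - n := by linear_combination h₂
  have hterm : ∀ b, ∀ a ∈ Finset.range p,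
      reflectionCoeff R₁ (p * b + a) * reflectionCoeff R₂ (p * b + a) =
        (reflectionCoeff R₁ b * reflectionCoeff R₂ b) *
          (dworkRatio p m a b (p * ρ₁ - m) * dworkRatio p n a b (p * ρ₂ - n)) := by
    intro b a ha
    rw [reflectionCoeff_mul_add hm (Finset.mem_range.mp ha) b h₁,
      reflectionCoeff_mul_add hn (Finset.mem_range.mp ha) b h₂, ← hR₁, ← hR₂, ← hclosed]
    ring
  have hfirst : ∑ k ∈ Finset.range p, reflectionCoeff R₁ k * reflectionCoeff R₂ k =
      ∑ a ∈ Finset.range p,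
        dworkRatio p m a 0 (p * ρ₁ - m) * dworkRatio p n a 0 (p * ρ₂ - n) := by
    refine Finset.sum_congr rfl fun a ha => ?_
    have := hterm 0 a ha
    rwa [mul_zero, zero_add, reflectionCoeff_zero, reflectionCoeff_zero, one_mul, one_mul] at this
  rw [Finset.sum_range_mul_block, hfirst, Finset.sum_mul, ← Finset.sum_sub_distrib]
  refine Finset.dvd_sum fun b _ => ?_
  rw [Finset.sum_congr rfl (hterm b), ← Finset.mul_sum, ← mul_sub]
  exact (pow_three_dvd_sum_dworkRatio_sub hp hm hn b ρ₁ ρ₂).mul_left _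

end Coefficients

theorem theorem3 (p : ℕ) [Fact p.Prime] (hp : 5 < p) (r₁ r₂ : ℚ)
    (hr₁ : ‖(r₁ : ℚ_[p])‖ = 1) (hr₂ : ‖(r₂ : ℚ_[p])‖ = 1)
    (hα : IsDashClosed p ({r₁, 1 - r₁, r₂, 1 - r₂} : Multiset ℚ)) :
    ∃ F : ℕ → ℤ_[p],
      (∀ s : ℕ, 1 ≤ s →
        (F s : ℚ_[p]) =
          ((dworkTrunc p ({r₁, 1 - r₁, r₂, 1 - r₂} : Multiset ℚ) s : ℚ) : ℚ_[p])) ∧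
      ∀ s : ℕ, 1 ≤ s → (p : ℤ_[p]) ^ 3 ∣ F (s + 1) - F s * F 1 := by
  obtain ⟨R₁, h₁⟩ : ∃ R : ℤ_[p], (R : ℚ_[p]) = r₁ := ⟨⟨_, hr₁.le⟩, rfl⟩
  obtain ⟨R₂, h₂⟩ : ∃ R : ℤ_[p], (R : ℚ_[p]) = r₂ := ⟨⟨_, hr₂.le⟩, rfl⟩
  refine ⟨fun s => ∑ k ∈ Finset.range (p ^ s), reflectionCoeff R₁ k * reflectionCoeff R₂ k,
    fun s _ => (cast_dworkTrunc h₁ h₂ s).symm, fun s _ => ?_⟩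
  obtain ⟨m, ρ₁, hm, hρ₁, hd₁, hd₁'⟩ := exists_firstDigit_neg h₁
  obtain ⟨n, ρ₂, hn, hρ₂, hd₂, hd₂'⟩ := exists_firstDigit_neg h₂
  have hclosed : ∀ k, reflectionCoeff ρ₁ k * reflectionCoeff ρ₂ k =
      reflectionCoeff R₁ k * reflectionCoeff R₂ k := by
    intro k
    have hR := cast_prod_map_risingFactorial h₁.symm (y₁ := 1 - r₁) (by push_cast; rw [h₁])
      h₂.symm (y₂ := 1 - r₂) (by push_cast; rw [h₂]) k
    have hρ := cast_prod_map_risingFactorial hd₁ hd₁' hd₂ hd₂' k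
    -- The dash may mix the two pairs, so only the product over all four parameters is compared.
    have hmap : ({dworkDash p r₁, dworkDash p (1 - r₁), dworkDash p r₂, dworkDash p (1 - r₂)} :
        Multiset ℚ) = {r₁, 1 - r₁, r₂, 1 - r₂} := by
      simpa [IsDashClosed] using hα
    rw [hmap, hR] at hρ
    have hne : (k.factorial : ℤ_[p]) ^ 4 ≠ 0 :=
      pow_ne_zero _ (Nat.cast_ne_zero.mpr k.factorial_ne_zero)
    exact (mul_left_cancel₀ hne (Subtype.ext hρ)).symm
  have h := pow_three_dvd_sum_reflectionCoeff_sub (by omega) hm hn hρ₁ hρ₂ hclosed (p ^ s)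
  simpa only [pow_succ', pow_zero, mul_one] using h
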